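/- Let $\mathcal V$ be a complex vector space, let $\mathcal V_{\rm nc} = \coprod_{n\ge 1}\mathcal V^{n\times n}$, and let $\Omega\subset\mathcal V_{\rm nc}$ be an arbitrary subset, with $\Omega_n = \Omega\cap\mathcal V^{n\times n}$. Let $\mathcal A$ be a unital $C^*$-algebra, let $\mathbb S\subset\mathcal A$ be an operator system (a linear subspace containing $1_{\mathcal A}$ and closed under $*$), and let $\mathcal Y$ be a complex Hilbert space. For $\mathbb E\in\{\mathbb S,\mathcal A\}$, a graded kernel on $\Omega$ with values in $\mathcal L(\mathbb E_{\rm nc},\mathcal L(\mathcal Y)_{\rm nc})$ assigns to each $Z\in\Omega_n$ and $W\in\Omega_m$ a linear map $K(Z,W)\colon\mathbb E^{n\times m}\to\mathcal L(\mathcal Y)^{n\times m}$. It is an nc kernel if $$\alpha\,K(Z,W)(P)\,\beta^* = K(\widetilde Z,\widetilde W)(\alpha P\beta^*)$$ whenever $Z\in\Omega_n$, $\widetilde Z\in\Omega_{\tilde n}$, $W\in\Omega_m$, $\widetilde W\in\Omega_{\tilde m}$, $\alpha\in\mathbb C^{\tilde n\times n}$, $\beta\in\mathbb C^{\tilde m\times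 m}$ satisfy $\alpha Z=\widetilde Z\alpha$ and $\beta W=\widetilde W\beta$, and $P\in\mathbb E^{n\times m}$. An nc kernel is completely positive (cp) if for all $Z_1,\dots,Z_k\in\Omega$, $Z_i\in\Omega_{n_i}$, $N=\sum_i n_i$, the map $[P_{ij}]\mapsto[K(Z_i,Z_j)(P_{ij})]$ (blocks $P_{ij}\in\mathbb E^{n_i\times n_j}$) from $\mathbb E^{N\times N}\subset\mathcal A^{N\times N}$ to $\mathcal L(\mathcal Y)^{N\times N}\cong\mathcal L(\mathcal Y^N)$ is completely positive. Theorem. Let $K$ be a cp nc kernel on $\Omega$ with values in $\mathcal L(\mathbb S_{\rm nc},\mathcal L(\mathcal Y)_{\rm nc})$. Then there is a cp nc kernel $\widehat K$ on $\Omega$ with values in $\mathcal L(\mathcal A_{\rm nc},\mathcal L(\mathcal Y)_{\rm nc})$, each $\widehat K(Z,W)$ being a bounded linear map, such that $\widehat K(Z,W)(P)=K(Z,W)(P)$ for all $Z\in\Omega_n$, $W\in\Omega_m$ and $P\in\mathbb S^{n\times m}$. -/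

import Mathlib

open scoped Matrix ComplexOrder

/-- A point of `𝒱_nc = ∐_{n ≥ 1} 𝒱^{n × n}`: a square matrix over `V` of some size `n ≥ 1`. -/
structure NcPoint (V : Type*) where
  size : ℕ
  size_pos : 0 < size
  mat : Matrix (Fin size) (Fin size) V

/-- The product `α X` of a scalar matrix `α` with a matrix `X` over a complex vector space. -/
def scalarMulLeft {E : Type*} [AddCommGroup E] [Module ℂ E] {p n m : ℕ}
    (α : Matrix (Fin p) (Fin n) ℂ) (X : Matrix (Fin n) (Fin m) E) : Matrix (Fin p) (Fin m) E :=
  Matrix.of fun i j => ∑ k, α i k • X k j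

/-- The product `X γ` of a matrix `X` over a complex vector space with a scalar matrix `γ`. -/
def scalarMulRight {E : Type*} [AddCommGroup E] [Module ℂ E] {n m q : ℕ}
    (X : Matrix (Fin n) (Fin m) E) (γ : Matrix (Fin m) (Fin q) ℂ) : Matrix (Fin n) (Fin q) E :=
  Matrix.of fun i j => ∑ k, γ k j • X i k

/-- A (concrete) operator system: a linear subspace of a unital C⋆-algebra which contains the
unit and is closed under the involution. -/
structure IsOperatorSystem {A : Type*} [CStarAlgebra A] (S : Submodule ℂ A) : Prop where
  one_mem : (1 : A) ∈ S
  star_mem : ∀ a ∈ S, star a ∈ S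

/-- Graded kernels on `Ω` with values in `ℒ(E_nc, ℒ(Y)_nc)`: `K(Z, W)` is a linear map from
`E^{n × m}` to `ℒ(Y)^{n × m}` if `Z`, `W` have sizes `n`, `m`. -/
abbrev GradedKernel {V : Type*} (Ω : Set (NcPoint V)) (E : Type*) [AddCommGroup E] [Module ℂ E]
    (Y : Type*) [NormedAddCommGroup Y] [InnerProductSpace ℂ Y] :=
  (Z W : Ω) → Matrix (Fin Z.1.size) (Fin W.1.size) E →ₗ[ℂ]
    Matrix (Fin Z.1.size) (Fin W.1.size) (Y →L[ℂ] Y)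

/-- A graded kernel is a nc kernel if it respects intertwinings. -/
def IsNcKernel {V : Type*} [AddCommGroup V] [Module ℂ V] {Ω : Set (NcPoint V)}
    {E : Type*} [AddCommGroup E] [Module ℂ E]
    {Y : Type*} [NormedAddCommGroup Y] [InnerProductSpace ℂ Y]
    (K : GradedKernel Ω E Y) : Prop :=
  ∀ (Z Z' W W' : Ω)
    (α : Matrix (Fin Z'.1.size) (Fin Z.1.size) ℂ) (β : Matrix (Fin W'.1.size) (Fin W.1.size) ℂ),
    scalarMulLeft α Z.1.mat = scalarMulRight Z'.1.mat α →
    scalarMulLeft β W.1.mat = scalarMulRight W'.1.mat β →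
    ∀ P : Matrix (Fin Z.1.size) (Fin W.1.size) E,
      scalarMulRight (scalarMulLeft α (K Z W P)) βᴴ
        = K Z' W' (scalarMulRight (scalarMulLeft α P) βᴴ)

/-- Positive elements of the C⋆-algebra `A^{I × I}`. -/
def IsPosMatrix {A : Type*} [CStarAlgebra A] {I : Type*} [Fintype I] (P : Matrix I I A) : Prop :=
  ∃ X : Matrix I I A, P = Xᴴ * X

/-- Positive elements of `ℒ(Y)^{I × I} ≅ ℒ(Y^I)`:
`∑_{i,j} ⟨T_{ij} y_j, y_i⟩ ≥ 0` for all `y ∈ Y^I`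
(Mathlib's inner product is linear in its second argument). -/
def IsPosOpMatrix {Y : Type*} [NormedAddCommGroup Y] [InnerProductSpace ℂ Y]
    {I : Type*} [Fintype I] (T : Matrix I I (Y →L[ℂ] Y)) : Prop :=
  ∀ y : I → Y, 0 ≤ ∑ i, ∑ j, inner ℂ (y i) (T i j (y j))

/-- Complete positivity of a linear map `φ : E^{I × I} → ℒ(Y)^{I × I}`, where `E` is embedded
into the C⋆-algebra `A` by `ι` (the inclusion of an operator system, or the identity of `A`):
for each `r`, applying `φ` to the blocks of an `r × r` block matrix over `E^{I × I}` that is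
positive in `A^{rI × rI}` gives a positive element of `ℒ(Y)^{rI × rI}`. -/
def IsCPMap {A : Type*} [CStarAlgebra A] {E : Type*} [AddCommGroup E] [Module ℂ E]
    (ι : E →ₗ[ℂ] A) {Y : Type*} [NormedAddCommGroup Y] [InnerProductSpace ℂ Y]
    {I : Type*} [Fintype I] (φ : Matrix I I E →ₗ[ℂ] Matrix I I (Y →L[ℂ] Y)) : Prop :=
  ∀ (r : ℕ) (P : Matrix (Fin r × I) (Fin r × I) E), IsPosMatrix (P.map ι) →
    IsPosOpMatrix (Matrix.of fun a b : Fin r × I =>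
      φ (Matrix.of fun i j => P (a.1, i) (b.1, j)) a.2 b.2)

/-- For points `Z_1, …, Z_k` of sizes `n_1, …, n_k`, the linear map
`[P_{ij}] ↦ [K(Z_i, Z_j)(P_{ij})]` on `N × N` matrices, `N = n_1 + ⋯ + n_k`, written as
`k × k` block matrices whose block `(i, j)` has size `n_i × n_j`. -/
def GradedKernel.blockMap {V : Type*} {Ω : Set (NcPoint V)}
    {E : Type*} [AddCommGroup E] [Module ℂ E]
    {Y : Type*} [NormedAddCommGroup Y] [InnerProductSpace ℂ Y]
    (K : GradedKernel Ω E Y) {k : ℕ} (Z : Fin k → Ω) :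
    Matrix (Σ i, Fin (Z i).1.size) (Σ i, Fin (Z i).1.size) E →ₗ[ℂ]
      Matrix (Σ i, Fin (Z i).1.size) (Σ i, Fin (Z i).1.size) (Y →L[ℂ] Y) where
  toFun P := Matrix.of fun p q =>
    K (Z p.1) (Z q.1) (Matrix.of fun i j => P ⟨p.1, i⟩ ⟨q.1, j⟩) p.2 q.2
  map_add' P Q := by
    ext1 p q
    exact congrFun (congrFun ((K (Z p.1) (Z q.1)).map_add
      (Matrix.of fun i j => P ⟨p.1, i⟩ ⟨q.1, j⟩) (Matrix.of fun i j => Q ⟨p.1, i⟩ ⟨q.1, j⟩)) p.2) q.2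
  map_smul' c P := by
    ext1 p q
    exact congrFun (congrFun ((K (Z p.1) (Z q.1)).map_smul c
      (Matrix.of fun i j => P ⟨p.1, i⟩ ⟨q.1, j⟩)) p.2) q.2

/-- Completely positive nc kernels with values in `ℒ(E_nc, ℒ(Y)_nc)`, where `E` is embedded into
the C⋆-algebra `A` by `ι`: nc kernels such that, for all `Z_1, …, Z_k ∈ Ω`, the map
`[P_{ij}] ↦ [K(Z_i, Z_j)(P_{ij})]` is completely positive. -/
structure IsCPNcKernel {V : Type*} [AddCommGroup V] [Module ℂ V] {Ω : Set (NcPoint V)}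
    {A : Type*} [CStarAlgebra A] {E : Type*} [AddCommGroup E] [Module ℂ E] (ι : E →ₗ[ℂ] A)
    {Y : Type*} [NormedAddCommGroup Y] [InnerProductSpace ℂ Y]
    (K : GradedKernel Ω E Y) : Prop where
  isNcKernel : IsNcKernel K
  isCP : ∀ (k : ℕ) (Z : Fin k → Ω), IsCPMap ι (K.blockMap Z)

/-! The kernel is traded for one scalar-valued object. Writing `κ s t a` for the entry `K(Z,W)(a
E_{kl})_{ij}` with `s = (Z,i,k)` and `t = (W,j,l)`, the forms `Q a (x, y) = ∑ ⟪x s, κ s t a (y t)⟫`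
on finitely supported `Y`-valued functions carry all of `K`, and complete positivity of `K` makes
`Q` completely positive on `S` (`isCPForm_formOfOperators`). An Arveson argument extends `Q` to `A`
(`IsCPForm.exists_extension`): in a Hamel basis, a family of forms is a linear functional on
finitely supported matrices over `A`. Its real part is nonnegative on the matrices over `S` with
positive real part, and scalar diagonal matrices dominate, so the M. Riesz extension theorem
applies.

Everything else follows from the Cauchy–Schwarz inequality `|Q a (x, y)|² ≤ ‖a‖² Q 1 (x, x) Q 1 (y,
y)` (`IsCPForm.norm_sq_le`). Since `1 ∈ S`, the extension has the same `Q 1` as `K`. Hence the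
extended forms are bounded on each pair of coordinates and come from operators. Moreover, the
intertwining condition says that certain vectors are null for `Q 1`; by Cauchy–Schwarz they are null
for every `Q a`, so the extension inherits the nc property without any further choice. -/

/-! ### Positive matrices over a C⋆-algebra -/

theorem CStarAlgebra.exists_star_mul_self_add {B : Type*} [CStarAlgebra B] (x y : B) :
    ∃ z : B, star x * x + star y * y = star z * z := by
  let _ := CStarAlgebra.spectralOrder B
  have _ := CStarAlgebra.spectralOrderedRing B
  exact CStarAlgebra.nonneg_iff_eq_star_mul_self.mp
    (add_nonneg (star_mul_self_nonneg x) (star_mul_self_nonneg y))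

theorem IsSelfAdjoint.exists_add_smul_one_eq_star_mul_self {B : Type*} [CStarAlgebra B] {x : B}
    (hx : IsSelfAdjoint x) : ∃ (r : ℝ) (z : B), x + (r : ℂ) • (1 : B) = star z * z := by
  let _ := CStarAlgebra.spectralOrder B
  have _ := CStarAlgebra.spectralOrderedRing B
  have h := hx.neg_algebraMap_norm_le_self
  rw [neg_le_iff_add_nonneg, Algebra.algebraMap_eq_smul_one] at h
  obtain ⟨z, hz⟩ := CStarAlgebra.nonneg_iff_eq_star_mul_self.mp h
  exact ⟨‖x‖, z, by rw [← hz, Complex.coe_smul]⟩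

namespace IsPosMatrix

variable {A : Type*} [CStarAlgebra A] {I J : Type*} [Fintype I] [Fintype J]

theorem add {P Q : Matrix I I A} (hP : IsPosMatrix P) (hQ : IsPosMatrix Q) :
    IsPosMatrix (P + Q) := by
  classical
  let _ := CStarAlgebra.spectralOrder A
  have _ := CStarAlgebra.spectralOrderedRing A
  obtain ⟨X, rfl⟩ := hP
  obtain ⟨Y, rfl⟩ := hQ
  obtain ⟨Z, hZ⟩ := CStarAlgebra.exists_star_mul_self_add (CStarMatrix.ofMatrix X)
    (CStarMatrix.ofMatrix Y)
  exact ⟨CStarMatrix.ofMatrix.symm Z, hZ⟩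

theorem zero : IsPosMatrix (0 : Matrix I I A) := ⟨0, by simp⟩

theorem sum {κ : Type*} (s : Finset κ) {P : κ → Matrix I I A} (h : ∀ k ∈ s, IsPosMatrix (P k)) :
    IsPosMatrix (∑ k ∈ s, P k) := by
  classical
  induction s using Finset.induction_on with
  | empty => simpa using zero
  | insert a s ha ih =>
    rw [Finset.sum_insert ha]
    exact (h a (by simp)).add (ih fun k hk => h k (by simp [hk]))

/-- `IsPosMatrix` asks for a square factor. A rectangular Gram matrix is the sum over the rows of
`X` of rank-one terms, and each row fits into a square matrix that is zero elsewhere. -/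
theorem conjTranspose_mul_self (X : Matrix J I A) : IsPosMatrix (Xᴴ * X) := by
  classical
  have h : Xᴴ * X = ∑ k, Matrix.of fun i j => star (X k i) * X k j := by
    ext i j
    simp [Matrix.mul_apply, Matrix.sum_apply]
  rw [h]
  refine sum _ fun k _ => ?_
  rcases isEmpty_or_nonempty I with hI | ⟨⟨i₀⟩⟩
  · exact ⟨0, by ext i; exact hI.elim i⟩
  · refine ⟨Matrix.of fun i j => if i = i₀ then X k j else 0, ?_⟩
    ext i j
    simp [Matrix.mul_apply, apply_ite]

theorem submatrix {P : Matrix I I A} (hP : IsPosMatrix P) (e : J → I) :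
    IsPosMatrix (P.submatrix e e) := by
  obtain ⟨X, rfl⟩ := hP
  exact conjTranspose_mul_self (X.submatrix id e)

/-- Compression of a positive matrix by a scalar matrix. -/
theorem congr {P : Matrix I I A} (hP : IsPosMatrix P) (c : I → J → ℂ) :
    IsPosMatrix (Matrix.of fun i j : J => ∑ p, ∑ q, (star (c p i) * c q j) • P p q) := by
  obtain ⟨X, rfl⟩ := hP
  let C : Matrix I J A := Matrix.of fun q j => c q j • 1
  have h : Cᴴ * (Xᴴ * X) * C = (X * C)ᴴ * (X * C) := by
    simp only [Matrix.conjTranspose_mul, Matrix.mul_assoc]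
  convert conjTranspose_mul_self (X * C) using 1
  rw [← h]
  ext i j
  rw [Matrix.mul_apply]
  simp_rw [Matrix.mul_apply (M := Cᴴ), Finset.sum_mul]
  rw [Finset.sum_comm]
  refine Finset.sum_congr rfl fun q _ => Finset.sum_congr rfl fun p _ => ?_
  simp [C, smul_smul, mul_comm]

theorem smul {P : Matrix I I A} (hP : IsPosMatrix P) {r : ℝ} (hr : 0 ≤ r) :
    IsPosMatrix (r • P) := by
  obtain ⟨X, rfl⟩ := hP
  refine ⟨Real.sqrt r • X, ?_⟩
  rw [Matrix.conjTranspose_smul, star_trivial, Matrix.smul_mul, Matrix.mul_smul, smul_smul,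
    Real.mul_self_sqrt hr]

theorem exists_add_smul_one [DecidableEq I] {P : Matrix I I A} (hP : Pᴴ = P) :
    ∃ r : ℝ, IsPosMatrix (P + (r : ℂ) • (1 : Matrix I I A)) := by
  let _ := CStarAlgebra.spectralOrder A
  have _ := CStarAlgebra.spectralOrderedRing A
  obtain ⟨r, Z, hZ⟩ := IsSelfAdjoint.exists_add_smul_one_eq_star_mul_self
    (show IsSelfAdjoint (CStarMatrix.ofMatrix P) from hP)
  exact ⟨r, CStarMatrix.ofMatrix.symm Z, hZ⟩

/-- The factor is upper triangular, with `c` such that `star c * c = ‖a‖² - star a * a`. This matrix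
is the source of the Cauchy–Schwarz inequality for completely positive forms. -/
theorem of_norm_sq (a : A) :
    IsPosMatrix !![1, a; star a, ((‖a‖ ^ 2 : ℝ) : ℂ) • (1 : A)] := by
  let _ := CStarAlgebra.spectralOrder A
  have _ := CStarAlgebra.spectralOrderedRing A
  obtain ⟨c, hc⟩ := CStarAlgebra.nonneg_iff_eq_star_mul_self.mp
    (sub_nonneg.mpr (CStarAlgebra.star_mul_le_algebraMap_norm_sq (a := a)))
  refine ⟨!![1, a; 0, c], ?_⟩
  rw [Algebra.algebraMap_eq_smul_one] at hc
  ext i j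
  fin_cases i <;> fin_cases j <;> simp [Matrix.mul_apply, ← hc, ← Complex.coe_smul]

end IsPosMatrix

theorem IsPosMatrix.isHermitian {A : Type*} [CStarAlgebra A] {I : Type*} [Fintype I]
    {P : Matrix I I A} (hP : IsPosMatrix P) : P.IsHermitian := by
  obtain ⟨X, rfl⟩ := hP
  exact Matrix.isHermitian_conjTranspose_mul_self X

/-- The matrix indexed by `J` is a compression of the one on `F₀` by a 0/1 matrix; `e` may repeat
indices or leave `F₀`. -/
theorem IsPosMatrix.of_support {A : Type*} [CStarAlgebra A] {B : Type*} {P : B → B → A}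
    {F₀ : Finset B} (hP : IsPosMatrix (Matrix.of fun i j : F₀ => P i j))
    (h : ∀ i j, P i j ≠ 0 → i ∈ F₀ ∧ j ∈ F₀) {J : Type*} [Fintype J] (e : J → B) :
    IsPosMatrix (Matrix.of fun i j : J => P (e i) (e j)) := by
  classical
  convert hP.congr (fun (p : F₀) (i : J) => if (p : B) = e i then (1 : ℂ) else 0) using 1
  ext i j
  by_cases hij : P (e i) (e j) = 0
  · simp only [Matrix.of_apply, hij]
    refine (Finset.sum_eq_zero fun p _ => Finset.sum_eq_zero fun q _ => ?_).symm
    by_cases hp : (p : B) = e i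
    · by_cases hq : (q : B) = e j
      · simp [hp, hq, hij]
      · simp [hq]
    · simp [hp]
  · obtain ⟨hi, hj⟩ := h _ _ hij
    simp only [Matrix.of_apply]
    rw [Finset.sum_eq_single ⟨e i, hi⟩, Finset.sum_eq_single ⟨e j, hj⟩]
    · simp
    · intro q _ hq
      simp [show (q : B) ≠ e j from fun h' => hq (Subtype.ext h')]
    · simp
    · intro q _ hq
      simp [show (q : B) ≠ e i from fun h' => hq (Subtype.ext h')]
    · simp

/-! ### Completely positive families of sesquilinear forms -/

/-- A family of sesquilinear forms on `X`, depending linearly on `a ∈ A`, is completely positive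
on the subspace `S` of `A`. -/
def IsCPForm {A : Type*} [CStarAlgebra A] (S : Submodule ℂ A) {X : Type*} [AddCommGroup X]
    [Module ℂ X] (Q : A →ₗ[ℂ] X →ₗ⋆[ℂ] X →ₗ[ℂ] ℂ) : Prop :=
  ∀ (n : ℕ) (P : Matrix (Fin n) (Fin n) A) (x : Fin n → X), (∀ i j, P i j ∈ S) → IsPosMatrix P →
    0 ≤ ∑ i, ∑ j, Q (P i j) (x i) (x j)

namespace IsCPForm

variable {A : Type*} [CStarAlgebra A] {S : Submodule ℂ A} {X : Type*} [AddCommGroup X]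
    [Module ℂ X] {Q : A →ₗ[ℂ] X →ₗ⋆[ℂ] X →ₗ[ℂ] ℂ}

theorem sum_nonneg (hQ : IsCPForm S Q) {I : Type*} [Fintype I] (P : Matrix I I A) (x : I → X)
    (hPS : ∀ i j, P i j ∈ S) (hP : IsPosMatrix P) : 0 ≤ ∑ i, ∑ j, Q (P i j) (x i) (x j) := by
  let e := (Fintype.equivFin I).symm
  have := hQ _ (P.submatrix e e) (x ∘ e) (fun i j => hPS _ _) (hP.submatrix e)
  simp only [Matrix.submatrix_apply, Function.comp] at this
  rw [← e.sum_comp]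
  simp_rw [← e.sum_comp (fun j => Q (P _ j) _ (x j))]
  exact this

theorem two_by_two (hS : IsOperatorSystem S) (hQ : IsCPForm S Q) {a : A} (ha : a ∈ S) (x y : X) :
    0 ≤ Q 1 x x + Q a x y + (Q (star a) y x + ((‖a‖ ^ 2 : ℝ) : ℂ) * Q 1 y y) := by
  have := hQ 2 !![1, a; star a, ((‖a‖ ^ 2 : ℝ) : ℂ) • (1 : A)] ![x, y] ?_
    (IsPosMatrix.of_norm_sq a)
  · simpa [Fin.sum_univ_two] using this
  · intro i j
    fin_cases i <;> fin_cases j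
    exacts [hS.one_mem, ha, hS.star_mem _ ha, S.smul_mem _ hS.one_mem]

theorem apply_one_self_nonneg (hS : IsOperatorSystem S) (hQ : IsCPForm S Q) (x : X) :
    0 ≤ Q 1 x x := by
  simpa using two_by_two hS hQ S.zero_mem x 0

/-- The sum in `two_by_two` is real. Its vanishing imaginary part for `x` gives the imaginary parts
of the identity, and for `Complex.I • x` the real parts. -/
theorem apply_star (hS : IsOperatorSystem S) (hQ : IsCPForm S Q) {a : A} (ha : a ∈ S) (x y : X) :
    Q (star a) y x = star (Q a x y) := by
  have hx := apply_one_self_nonneg hS hQ x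
  have hy := apply_one_self_nonneg hS hQ y
  have h1 := two_by_two hS hQ ha x y
  have h2 := two_by_two hS hQ ha (Complex.I • x) y
  simp only [map_smulₛₗ, LinearMap.smul_apply, Complex.nonneg_iff] at hx hy h1 h2
  simp [-Complex.ofReal_pow] at hx hy h1 h2
  apply Complex.ext
  · simp
    linear_combination hx.2 + ‖a‖ ^ 2 * hy.2 - h2.2
  · simp
    linear_combination hx.2 + ‖a‖ ^ 2 * hy.2 - h1.2

theorem norm_sq_le (hS : IsOperatorSystem S) (hQ : IsCPForm S Q) {a : A} (ha : a ∈ S) (x y : X) :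
    ‖Q a x y‖ ^ 2 ≤ (Q 1 x x).re * (‖a‖ ^ 2 * (Q 1 y y).re) := by
  have hx := (Complex.nonneg_iff.1 (apply_one_self_nonneg hS hQ x)).1
  have hy := (Complex.nonneg_iff.1 (apply_one_self_nonneg hS hQ y)).1
  set z := Q a x y with hz
  by_cases hz0 : z = 0
  · rw [hz0]
    simpa using mul_nonneg hx (mul_nonneg (sq_nonneg ‖a‖) hy)
  have hzpos : 0 < ‖z‖ ^ 2 := by positivity
  -- Replacing `x` by `-t z x` turns both cross terms into `-t ‖z‖²`; the quadratic in `t` is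
  -- nonnegative, so its discriminant is not positive.
  have key : ∀ t : ℝ, 0 ≤ (‖z‖ ^ 2 * (Q 1 x x).re) * (t * t) + (-2 * ‖z‖ ^ 2) * t
      + ‖a‖ ^ 2 * (Q 1 y y).re := by
    intro t
    have h := two_by_two hS hQ ha ((-(t : ℂ) * z) • x) y
    rw [apply_star hS hQ ha] at h
    have h' := (Complex.nonneg_iff.1 h).1
    have e : ‖z‖ ^ 2 = z.re * z.re + z.im * z.im := by
      rw [← Complex.normSq_eq_norm_sq, Complex.normSq_apply]
    have hre := (Complex.nonneg_iff.1 (apply_one_self_nonneg hS hQ x)).2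
    simp only [map_smulₛₗ, LinearMap.smul_apply, ← hz] at h'
    simp [-Complex.ofReal_pow, ← hre] at h'
    rw [e]
    nlinarith [h']
  have := discrim_le_zero key
  rw [discrim] at this
  have h2 : ‖z‖ ^ 2 * ‖z‖ ^ 2 ≤ ‖z‖ ^ 2 * ((Q 1 x x).re * (‖a‖ ^ 2 * (Q 1 y y).re)) := by
    linarith
  exact le_of_mul_le_mul_left h2 hzpos

end IsCPForm

/-! ### Arveson extension by way of the M. Riesz extension theorem -/

section

variable {A : Type*} [CStarAlgebra A] {X : Type*} [AddCommGroup X] [Module ℂ X] {B : Type*}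

/-- The finitely supported matrix with entries `conj (x i) * y j • a`, where `x i`, `y j` are the
coordinates of `x`, `y` in the basis `b`. -/
noncomputable def Module.Basis.outerMatrix (b : Module.Basis B ℂ X) (a : A) (x y : X) :
    B × B →₀ A :=
  Finsupp.onFinset ((b.repr x).support ×ˢ (b.repr y).support)
    (fun p => (star (b.repr x p.1) * b.repr y p.2) • a) (by
      intro p hp
      simp only [Finset.mem_product, Finsupp.mem_support_iff]
      constructor <;> intro h <;> simp [h] at hp)

@[simp]
theorem Module.Basis.outerMatrix_apply (b : Module.Basis B ℂ X) (a : A) (x y : X) (p : B × B) :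
    b.outerMatrix a x y p = (star (b.repr x p.1) * b.repr y p.2) • a := rfl

/-- The family of sesquilinear forms given by a linear functional on finitely supported matrices
over `A`, with respect to the basis `b`. -/
noncomputable def Module.Basis.formOfDual (b : Module.Basis B ℂ X) (G : (B × B →₀ A) →ₗ[ℂ] ℂ) :
    A →ₗ[ℂ] X →ₗ⋆[ℂ] X →ₗ[ℂ] ℂ where
  toFun a := LinearMap.mk₂'ₛₗ (starRingEnd ℂ) (RingHom.id ℂ) (fun x y => G (b.outerMatrix a x y))
    (fun x x' y => by
      rw [← map_add]; congr 1; ext p; simp [add_mul, add_smul])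
    (fun c x y => by
      rw [← map_smul]; congr 1; ext p; simp [smul_smul, mul_assoc])
    (fun x y y' => by
      rw [← map_add]; congr 1; ext p; simp [mul_add, add_smul])
    (fun c x y => by
      rw [← map_smul]; congr 1; ext p; simp [smul_smul, mul_left_comm])
  map_add' a a' := by
    ext x y
    simp only [LinearMap.mk₂'ₛₗ_apply, LinearMap.add_apply]
    rw [← map_add]; congr 1; ext p; simp
  map_smul' c a := by
    ext x y
    simp only [LinearMap.mk₂'ₛₗ_apply, LinearMap.smul_apply, RingHom.id_apply]
    rw [← map_smul]; congr 1; ext p; simp [smul_smul, mul_comm]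

theorem Module.Basis.formOfDual_apply (b : Module.Basis B ℂ X) (G : (B × B →₀ A) →ₗ[ℂ] ℂ) (a : A)
    (x y : X) : b.formOfDual G a x y = G (b.outerMatrix a x y) := rfl

/-- The linear functional on finitely supported matrices over `A` given by a family of
sesquilinear forms, with respect to the basis `b`. -/
noncomputable def Module.Basis.dualOfForm (b : Module.Basis B ℂ X)
    (Q : A →ₗ[ℂ] X →ₗ⋆[ℂ] X →ₗ[ℂ] ℂ) : (B × B →₀ A) →ₗ[ℂ] ℂ :=
  Finsupp.lsum ℂ fun p =>
    { toFun := fun a => Q a (b p.1) (b p.2)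
      map_add' := by simp
      map_smul' := by simp }

theorem Module.Basis.dualOfForm_apply (b : Module.Basis B ℂ X)
    (Q : A →ₗ[ℂ] X →ₗ⋆[ℂ] X →ₗ[ℂ] ℂ) (P : B × B →₀ A) {F : Finset B}
    (hF : ∀ p, P p ≠ 0 → p.1 ∈ F ∧ p.2 ∈ F) :
    b.dualOfForm Q P = ∑ i : F, ∑ j : F, Q (P (i, j)) (b i) (b j) := by
  rw [dualOfForm, Finsupp.lsum_apply, Finsupp.sum_of_support_subset (s := F ×ˢ F)]
  · rw [Finset.sum_product, ← Finset.sum_coe_sort F]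
    refine Finset.sum_congr rfl fun i _ => ?_
    rw [← Finset.sum_coe_sort F]
    rfl
  · intro p hp
    simpa using hF p (by simpa using hp)
  · simp

theorem Finsupp.exists_finset_support_prod {M : Type*} [Zero M] (P : B × B →₀ M) :
    ∃ F : Finset B, ∀ p, P p ≠ 0 → p.1 ∈ F ∧ p.2 ∈ F := by
  classical
  refine ⟨P.support.image Prod.fst ∪ P.support.image Prod.snd, fun p hp => ?_⟩
  have hp' : p ∈ P.support := by simpa using hp
  exact ⟨Finset.mem_union_left _ (Finset.mem_image_of_mem _ hp'),
    Finset.mem_union_right _ (Finset.mem_image_of_mem _ hp')⟩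

variable (A B) in
/-- The finitely supported matrices over `A` whose real part is positive. -/
def finsuppAccretiveCone : PointedCone ℝ (B × B →₀ A) where
  carrier := {P | ∀ F : Finset B, IsPosMatrix (Matrix.of fun i j : F => P (i, j) + star (P (j, i)))}
  add_mem' {P P'} hP hP' F := by
    convert (hP F).add (hP' F) using 1
    ext i j
    simp only [Matrix.of_apply, Matrix.add_apply, Finsupp.add_apply, star_add]
    abel
  zero_mem' F := by
    convert IsPosMatrix.zero (A := A) (I := F) using 1
    ext i j
    simp
  smul_mem' c P hP F := by
    convert (hP F).smul c.2 using 1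
    ext i j
    change (c : ℝ) • P (i, j) + star ((c : ℝ) • P (j, i)) = (c : ℝ) • (P (i, j) + star (P (j, i)))
    rw [star_smul, star_trivial, smul_add]

/-- This is the cofinality hypothesis of the Riesz theorem, met inside every operator system because
`D` has scalar entries. The diagonal entry is `r / 2` because the cone tests `D + D⋆`. -/
theorem exists_diagonal_add_mem_finsuppAccretiveCone (P : B × B →₀ A) :
    ∃ D : B × B →₀ A, (∀ p, ∃ c : ℂ, D p = c • (1 : A)) ∧ D + P ∈ finsuppAccretiveCone A B := by
  classical
  obtain ⟨F, hF⟩ := P.exists_finset_support_prod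
  obtain ⟨r, hr⟩ := IsPosMatrix.exists_add_smul_one (A := A)
    (P := Matrix.of fun i j : F => P (i, j) + star (P (j, i)))
    (by ext i j; simp [add_comm])
  let D : B × B →₀ A := Finsupp.onFinset (F ×ˢ F)
    (fun p => (if p.1 = p.2 ∧ p.1 ∈ F then ((r / 2 : ℝ) : ℂ) else 0) • (1 : A)) (by
      intro p hp
      have : p.1 = p.2 ∧ p.1 ∈ F := by
        by_contra h
        simp [h] at hp
      rw [Finset.mem_product, ← this.1]
      exact ⟨this.2, this.2⟩)
  have hD : ∀ p, D p = (if p.1 = p.2 ∧ p.1 ∈ F then ((r / 2 : ℝ) : ℂ) else 0) • (1 : A) :=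
    fun _ => rfl
  refine ⟨D, fun p => ⟨_, hD p⟩, fun F' => ?_⟩
  refine IsPosMatrix.of_support (P := fun i j => (D + P) (i, j) + star ((D + P) (j, i)))
    (F₀ := F) ?_ ?_ (Subtype.val : F' → B)
  · convert hr using 1
    ext i j
    by_cases h : i = j
    · subst h
      have h2 : ((r : ℂ) • (1 : A)) =
          ((r / 2 : ℝ) : ℂ) • (1 : A) + ((r / 2 : ℝ) : ℂ) • (1 : A) := by
        rw [← add_smul, ← Complex.ofReal_add, add_halves]
      simp only [Matrix.of_apply, Finsupp.add_apply, Matrix.add_apply, hD, Matrix.smul_apply,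
        Matrix.one_apply_eq, i.2, and_self, if_true, h2, star_add, star_smul, star_one,
        Complex.star_def, Complex.conj_ofReal]
      abel
    · have h' : (i : B) ≠ j := fun h' => h (Subtype.ext h')
      simp [hD, h, Ne.symm h]
  · intro i j hij
    by_contra hcon
    apply hij
    have h1 : P (i, j) = 0 := by
      by_contra h; exact hcon (hF _ h)
    have h2 : P (j, i) = 0 := by
      by_contra h; exact hcon (hF _ h).symm
    have h3 : ¬(i = j ∧ i ∈ F) := fun h => hcon ⟨h.2, h.1 ▸ h.2⟩
    have h4 : ¬(j = i ∧ j ∈ F) := fun h => hcon ⟨h.1 ▸ h.2, h.2⟩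
    simp [hD, h1, h2, h3, h4]

/-- By `apply_star`, the functional takes `P + P⋆` to twice the real part of its value at `P`, and
`P + P⋆` is a positive matrix over `S`. -/
theorem IsCPForm.re_dualOfForm_nonneg {S : Submodule ℂ A} (hS : IsOperatorSystem S)
    {Q : A →ₗ[ℂ] X →ₗ⋆[ℂ] X →ₗ[ℂ] ℂ} (hQ : IsCPForm S Q) (b : Module.Basis B ℂ X)
    {P : B × B →₀ A} (hPS : ∀ p, P p ∈ S) (hP : P ∈ finsuppAccretiveCone A B) :
    0 ≤ (b.dualOfForm Q P).re := by
  obtain ⟨F, hF⟩ := P.exists_finset_support_prod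
  have h := hQ.sum_nonneg _ (fun i : F => b i)
    (fun i j => S.add_mem (hPS (i, j)) (hS.star_mem _ (hPS (j, i)))) (hP F)
  simp only [map_add, LinearMap.add_apply, hQ.apply_star hS (hPS _),
    Finset.sum_add_distrib] at h
  rw [Finset.sum_comm (f := fun i j : F => star (Q (P (j, i)) (b j) (b i)))] at h
  simp only [← star_sum] at h
  rw [← b.dualOfForm_apply Q P hF] at h
  have := (Complex.nonneg_iff.1 h).1
  simp at this
  linarith

/-- Arveson's extension theorem, for families of sesquilinear forms. -/
theorem IsCPForm.exists_extension {S : Submodule ℂ A} (hS : IsOperatorSystem S)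
    {Q : A →ₗ[ℂ] X →ₗ⋆[ℂ] X →ₗ[ℂ] ℂ} (hQ : IsCPForm S Q) :
    ∃ Q' : A →ₗ[ℂ] X →ₗ⋆[ℂ] X →ₗ[ℂ] ℂ, IsCPForm ⊤ Q' ∧ ∀ a ∈ S, Q' a = Q a := by
  let b := Module.Basis.ofVectorSpace ℂ X
  let B := Module.Basis.ofVectorSpaceIndex ℂ X
  let D : Submodule ℝ (B × B →₀ A) :=
    { carrier := {P | ∀ p, P p ∈ S}
      add_mem' := fun hP hP' p => S.add_mem (hP p) (hP' p)
      zero_mem' := fun p => S.zero_mem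
      smul_mem' := fun c P hP p => by
        have := S.smul_mem (c : ℂ) (hP p)
        rwa [Complex.coe_smul] at this }
  let f : (B × B →₀ A) →ₗ[ℝ] ℝ := Complex.reLm.comp ((b.dualOfForm Q).restrictScalars ℝ)
  obtain ⟨g, hgf, hg⟩ := riesz_extension (finsuppAccretiveCone A B) ⟨D, f.comp D.subtype⟩
    (fun P hP => hQ.re_dualOfForm_nonneg hS b P.2 hP)
    (fun P => by
      obtain ⟨d, hd, hdP⟩ := exists_diagonal_add_mem_finsuppAccretiveCone P
      refine ⟨⟨d, fun p => ?_⟩, hdP⟩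
      obtain ⟨c, hc⟩ := hd p
      rw [hc]
      exact S.smul_mem _ hS.one_mem)
  have hgf' : ∀ P : B × B →₀ A, (∀ p, P p ∈ S) → g P = (b.dualOfForm Q P).re :=
    fun P hP => hgf ⟨P, hP⟩
  -- The complex functional with real part `g`. It agrees with the functional of `Q` over `S`, since
  -- entries in `S` stay in `S` under multiplication by `Complex.I`.
  let G : (B × B →₀ A) →ₗ[ℂ] ℂ := Module.Dual.extendRCLike g
  have hGre : ∀ P, (G P).re = g P := fun P => Module.Dual.re_extendRCLike_apply (𝕜 := ℂ) g P
  have hGim : ∀ P, (G P).im = -g (Complex.I • P) :=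
    fun P => Module.Dual.im_extendRCLike_apply (𝕜 := ℂ) g P
  refine ⟨b.formOfDual G, fun n P x _ hP => ?_, fun a ha => ?_⟩
  · simp only [Module.Basis.formOfDual_apply, ← map_sum]
    set T : B × B →₀ A := ∑ i, ∑ j, b.outerMatrix (P i j) (x i) (x j) with hT
    have hTpos : ∀ F : Finset B, IsPosMatrix (Matrix.of fun i j : F => T (i, j)) := by
      intro F
      convert hP.congr (fun p (i : F) => b.repr (x p) i) using 1
      ext i j
      simp [hT, Finsupp.finsetSum_apply]
    have hTstar : ∀ i j, star (T (j, i)) = T (i, j) := by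
      intro i j
      classical
      have := (hTpos {i, j}).isHermitian.apply ⟨i, by simp⟩ ⟨j, by simp⟩
      exact this
    -- As `T` is Hermitian, `c • T` has zero real part and so lies in the cone; using `c =
    -- ±Complex.I` forces `G T` to be real.
    have hskew : ∀ c : ℂ, star c = -c → 0 ≤ g (c • T) := by
      intro c hc
      refine hg _ fun F => ?_
      convert IsPosMatrix.zero (A := A) (I := F) using 1
      ext i j
      simp only [Matrix.of_apply, Finsupp.smul_apply, star_smul, hTstar, hc]
      simp
    rw [Complex.nonneg_iff, hGre, hGim]
    constructor
    · refine hg _ fun F => ?_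
      simp only [hTstar]
      exact (hTpos F).add (hTpos F)
    · have h1 := hskew Complex.I (by simp)
      have h2 := hskew (-Complex.I) (by simp)
      rw [neg_smul, map_neg] at h2
      linarith
  · have hG : ∀ P : B × B →₀ A, (∀ p, P p ∈ S) → G P = b.dualOfForm Q P := by
      intro P hP
      apply Complex.ext
      · rw [hGre, hgf' P hP]
      · rw [hGim, hgf' _ fun p => S.smul_mem _ (hP p)]
        simp
    refine b.ext fun i => b.ext fun j => ?_
    have : b.outerMatrix a (b i) (b j) = Finsupp.single (i, j) a := by
      classical
      ext p
      rw [Module.Basis.outerMatrix_apply, b.repr_self, b.repr_self]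
      rcases p with ⟨p, q⟩
      by_cases hp : i = p <;> by_cases hq : j = q <;> simp [hp, hq]
    rw [Module.Basis.formOfDual_apply, hG, this]
    · simp [Module.Basis.dualOfForm]
    · intro p
      exact S.smul_mem _ ha

end

/-! ### Operators and sesquilinear forms -/

section

variable {A : Type*} [NormedAddCommGroup A] [NormedSpace ℂ A]
  {Y : Type*} [NormedAddCommGroup Y] [InnerProductSpace ℂ Y]

/-- A bounded family of sesquilinear forms on a Hilbert space is given by operators. -/
theorem exists_continuous_operator_of_form [CompleteSpace Y] {X : Type*} [AddCommGroup X]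
    [Module ℂ X] (Q : A →ₗ[ℂ] X →ₗ⋆[ℂ] X →ₗ[ℂ] ℂ) (f g : Y →ₗ[ℂ] X) {C : ℝ} (hC : 0 ≤ C)
    (h : ∀ a y y', ‖Q a (f y) (g y')‖ ≤ C * ‖a‖ * ‖y‖ * ‖y'‖) :
    ∃ T : A →ₗ[ℂ] (Y →L[ℂ] Y), Continuous T ∧
      ∀ a y y', inner ℂ y (T a y') = Q a (f y) (g y') := by
  let R : A → (Y →L[ℂ] Y) := fun a => ContinuousLinearMap.adjoint
    (InnerProductSpace.continuousLinearMapOfBilin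
      (LinearMap.mkContinuous₂ (((Q a).compl₂ g).comp f) (C * ‖a‖) (h a)))
  have hR : ∀ a y y', inner ℂ y (R a y') = Q a (f y) (g y') := by
    intro a y y'
    rw [ContinuousLinearMap.adjoint_inner_right,
      InnerProductSpace.continuousLinearMapOfBilin_apply]
    rfl
  let T : A →ₗ[ℂ] (Y →L[ℂ] Y) :=
    { toFun := R
      map_add' := fun a a' => by
        ext y'
        refine ext_inner_left ℂ fun y => ?_
        simp [hR, inner_add_right]
      map_smul' := fun c a => by
        ext y'
        refine ext_inner_left ℂ fun y => ?_
        simp [hR, inner_smul_right] }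
  refine ⟨T, (T.mkContinuous C fun a => ?_).continuous, hR⟩
  refine ContinuousLinearMap.opNorm_le_bound _ (by positivity) fun y' => ?_
  -- Testing against `R a y'` itself and cancelling one factor `‖R a y'‖` bounds the operator norm.
  have h1 := h a (R a y') y'
  rw [← hR, inner_self_eq_norm_sq_to_K] at h1
  change ‖R a y'‖ ≤ _
  rcases (norm_nonneg (R a y')).eq_or_lt with h0 | h0
  · rw [← h0]
    positivity
  · have h2 : ‖R a y'‖ * ‖R a y'‖ ≤ ‖R a y'‖ * (C * ‖a‖ * ‖y'‖) := by
      simp only [norm_pow, RCLike.norm_ofReal, abs_norm] at h1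
      linarith
    exact le_of_mul_le_mul_left h2 h0

/-- The sesquilinear forms on finitely supported `Y`-valued functions given by a matrix of
operators. -/
noncomputable def formOfOperators {J : Type*} (κ : J → J → A →ₗ[ℂ] (Y →L[ℂ] Y)) :
    A →ₗ[ℂ] (J →₀ Y) →ₗ⋆[ℂ] (J →₀ Y) →ₗ[ℂ] ℂ where
  toFun a := LinearMap.mk₂'ₛₗ (starRingEnd ℂ) (RingHom.id ℂ)
    (fun x y => x.sum fun s u => y.sum fun t v => inner ℂ u (κ s t a v))
    (fun x x' y => by
      rw [Finsupp.sum_add_index' (by simp) (by simp [Finsupp.sum_add])])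
    (fun c x y => by
      rw [Finsupp.sum_smul_index' (by simp)]
      simp [Finsupp.sum, Finset.sum_mul, mul_comm])
    (fun x y y' => by
      rw [← Finsupp.sum_add]
      refine Finsupp.sum_congr fun s _ => ?_
      rw [Finsupp.sum_add_index' (by simp) (by simp)])
    (fun c x y => by
      rw [RingHom.id_apply, Finsupp.smul_sum]
      refine Finsupp.sum_congr fun s _ => ?_
      rw [Finsupp.sum_smul_index' (by simp), Finsupp.smul_sum]
      simp)
  map_add' a a' := by
    refine LinearMap.ext fun x => LinearMap.ext fun y => ?_
    simp [Finsupp.sum_add]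
  map_smul' c a := by
    refine LinearMap.ext fun x => LinearMap.ext fun y => ?_
    simp [Finsupp.sum, Finset.mul_sum]

theorem formOfOperators_apply {J : Type*} (κ : J → J → A →ₗ[ℂ] (Y →L[ℂ] Y)) (a : A)
    (x y : J →₀ Y) :
    formOfOperators κ a x y = x.sum fun s u => y.sum fun t v => inner ℂ u (κ s t a v) := rfl

@[simp]
theorem formOfOperators_single {J : Type*} (κ : J → J → A →ₗ[ℂ] (Y →L[ℂ] Y)) (a : A)
    (s t : J) (u v : Y) :
    formOfOperators κ a (Finsupp.single s u) (Finsupp.single t v) = inner ℂ u (κ s t a v) := by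
  simp [formOfOperators_apply]

theorem formOfOperators_eq_sum {J : Type*} (κ : J → J → A →ₗ[ℂ] (Y →L[ℂ] Y)) (a : A)
    {x y : J →₀ Y} {L : Type*} [Fintype L] (e : L ↪ J) (hx : ∀ s, x s ≠ 0 → s ∈ Set.range e)
    (hy : ∀ s, y s ≠ 0 → s ∈ Set.range e) :
    formOfOperators κ a x y = ∑ s, ∑ t, inner ℂ (x (e s)) (κ (e s) (e t) a (y (e t))) := by
  rw [formOfOperators_apply, Finsupp.sum_of_support_subset (s := Finset.univ.map e), Finset.sum_map]
  · refine Finset.sum_congr rfl fun s _ => ?_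
    rw [Finsupp.sum_of_support_subset (s := Finset.univ.map e), Finset.sum_map]
    · intro t ht
      simpa using hy t (by simpa using ht)
    · simp
  · intro t ht
    simpa using hx t (by simpa using ht)
  · simp

end

/-! ### Passage between graded kernels and forms -/

theorem IsCPMap.sum_nonneg {A : Type*} [CStarAlgebra A] {E : Type*} [AddCommGroup E] [Module ℂ E]
    {ι : E →ₗ[ℂ] A} {Y : Type*} [NormedAddCommGroup Y] [InnerProductSpace ℂ Y]
    {I : Type*} [Fintype I] {φ : Matrix I I E →ₗ[ℂ] Matrix I I (Y →L[ℂ] Y)} (hφ : IsCPMap ι φ)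
    {R : Type*} [Fintype R] (P : R → R → Matrix I I E)
    (hP : IsPosMatrix (Matrix.of fun a b : R × I => ι (P a.1 b.1 a.2 b.2))) (y : R → I → Y) :
    0 ≤ ∑ a, ∑ i, ∑ b, ∑ j, inner ℂ (y a i) (φ (P a b) i j (y b j)) := by
  let e := (Fintype.equivFin R).symm
  have h := hφ (Fintype.card R) (Matrix.of fun a b => P (e a.1) (e b.1) a.2 b.2)
    (hP.submatrix (Prod.map e id)) (fun a => y (e a.1) a.2)
  simp only [Fintype.sum_prod_type] at h
  rw [← e.sum_comp]
  simp_rw [← e.sum_comp (fun b => ∑ j, inner ℂ _ (φ (P _ b) _ j (y b j)))]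
  exact h

theorem Finset.sum_comm_pairs {ι₁ ι₂ ι₃ ι₄ M : Type*} [AddCommMonoid M] (s₁ : Finset ι₁)
    (s₂ : Finset ι₂) (s₃ : Finset ι₃) (s₄ : Finset ι₄) (f : ι₁ → ι₂ → ι₃ → ι₄ → M) :
    ∑ a ∈ s₁, ∑ b ∈ s₂, ∑ c ∈ s₃, ∑ d ∈ s₄, f a b c d
      = ∑ c ∈ s₃, ∑ d ∈ s₄, ∑ a ∈ s₁, ∑ b ∈ s₂, f a b c d := by
  have h := Finset.sum_comm (s := s₁ ×ˢ s₂) (t := s₃ ×ˢ s₄) (f := fun x y => f x.1 x.2 y.1 y.2)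
  simpa only [Finset.sum_product] using h

/-- Triples `(Z, i, k)` of a point `Z ∈ Ω` and a pair of indices up to the size of `Z`. -/
abbrev NcPoint.IndexPair {V : Type*} (Ω : Set (NcPoint V)) :=
  Σ Z : Ω, Fin Z.1.size × Fin Z.1.size

namespace GradedKernel

variable {V : Type*} {Ω : Set (NcPoint V)} {E : Type*} [AddCommGroup E] [Module ℂ E]
  {Y : Type*} [NormedAddCommGroup Y] [InnerProductSpace ℂ Y]

/-- The coefficients of a graded kernel: `K(Z, W)(a E_{kl})_{ij}`. -/
def coeff (K : GradedKernel Ω E Y) (s t : NcPoint.IndexPair Ω) : E →ₗ[ℂ] (Y →L[ℂ] Y) where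
  toFun a := K s.1 t.1 (Matrix.single s.2.2 t.2.2 a) s.2.1 t.2.1
  map_add' a a' := by rw [Matrix.single_add, map_add, Matrix.add_apply]
  map_smul' c a := by rw [← Matrix.smul_single, map_smul, Matrix.smul_apply, RingHom.id_apply]

theorem coeff_apply (K : GradedKernel Ω E Y) (s t : NcPoint.IndexPair Ω) (a : E) :
    K.coeff s t a = K s.1 t.1 (Matrix.single s.2.2 t.2.2 a) s.2.1 t.2.1 := rfl

theorem apply_eq_sum_coeff (K : GradedKernel Ω E Y) (Z W : Ω)
    (P : Matrix (Fin Z.1.size) (Fin W.1.size) E) (i : Fin Z.1.size) (j : Fin W.1.size) :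
    K Z W P i j = ∑ k, ∑ l, K.coeff ⟨Z, i, k⟩ ⟨W, j, l⟩ (P k l) := by
  conv_lhs => rw [Matrix.matrix_eq_sum_single P]
  simp [Matrix.sum_apply, coeff_apply]

/-- The graded kernel with given coefficients. -/
def ofCoeff (T : NcPoint.IndexPair Ω → NcPoint.IndexPair Ω → E →ₗ[ℂ] (Y →L[ℂ] Y)) :
    GradedKernel Ω E Y := fun Z W =>
  { toFun := fun P => Matrix.of fun i j => ∑ k, ∑ l, T ⟨Z, i, k⟩ ⟨W, j, l⟩ (P k l)
    map_add' := fun P P' => by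
      ext1 i j
      simp [Finset.sum_add_distrib]
    map_smul' := fun c P => by
      ext1 i j
      simp [Finset.smul_sum] }

theorem ofCoeff_apply (T : NcPoint.IndexPair Ω → NcPoint.IndexPair Ω → E →ₗ[ℂ] (Y →L[ℂ] Y))
    (Z W : Ω) (P : Matrix (Fin Z.1.size) (Fin W.1.size) E) (i : Fin Z.1.size) (j : Fin W.1.size) :
    ofCoeff T Z W P i j = ∑ k, ∑ l, T ⟨Z, i, k⟩ ⟨W, j, l⟩ (P k l) := rfl

variable {A : Type*} [CStarAlgebra A]

theorem isCPMap_blockMap_ofCoeff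
    {T : NcPoint.IndexPair Ω → NcPoint.IndexPair Ω → A →ₗ[ℂ] (Y →L[ℂ] Y)}
    {Q : A →ₗ[ℂ] (NcPoint.IndexPair Ω →₀ Y) →ₗ⋆[ℂ] (NcPoint.IndexPair Ω →₀ Y) →ₗ[ℂ] ℂ}
    (hQ : IsCPForm ⊤ Q)
    (hT : ∀ s t a u v, inner ℂ u (T s t a v) = Q a (Finsupp.single s u) (Finsupp.single t v))
    (k : ℕ) (Z : Fin k → Ω) :
    IsCPMap (LinearMap.id : A →ₗ[ℂ] A) ((ofCoeff T).blockMap Z) := by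
  intro r P hP y
  -- An index of the enlarged matrix is a row index of the block map together with a column index
  -- `k` to be summed. The entry of `P` depends only on the block and on `k`, the vector on all of
  -- the index.
  have h := hQ.sum_nonneg
    (I := Σ a : Fin r × (Σ i, Fin (Z i).1.size), Fin (Z a.2.1).1.size)
    (P.submatrix (fun a => (a.1.1, ⟨a.1.2.1, a.2⟩)) (fun a => (a.1.1, ⟨a.1.2.1, a.2⟩)))
    (fun a => Finsupp.single ⟨Z a.1.2.1, a.1.2.2, a.2⟩ (y a.1)) (fun _ _ => trivial)
    (hP.submatrix _)
  simp only [Fintype.sum_sigma] at h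
  convert h using 1
  refine Finset.sum_congr rfl fun a _ => ?_
  rw [Finset.sum_comm]
  refine Finset.sum_congr rfl fun b _ => ?_
  simp only [Matrix.of_apply, blockMap, LinearMap.coe_mk, AddHom.coe_mk, ofCoeff_apply,
    sum_apply, inner_sum, hT, Matrix.submatrix_apply]

/-- The families of vectors in the null space that express the nc condition. -/
noncomputable def shiftLeft {Z Z' : Ω} (α : Matrix (Fin Z'.1.size) (Fin Z.1.size) ℂ)
    (i' : Fin Z'.1.size) (k : Fin Z.1.size) (y : Y) : NcPoint.IndexPair Ω →₀ Y :=
  ∑ i, star (α i' i) • Finsupp.single ⟨Z, i, k⟩ y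

/-- The vector to which the nc condition equates `shiftLeft`. -/
noncomputable def shiftRight {Z Z' : Ω} (α : Matrix (Fin Z'.1.size) (Fin Z.1.size) ℂ)
    (i' : Fin Z'.1.size) (k : Fin Z.1.size) (y : Y) : NcPoint.IndexPair Ω →₀ Y :=
  ∑ k', star (α k' k) • Finsupp.single ⟨Z', i', k'⟩ y

/-- Paired with vectors, the two sides of the nc identity are the sums of `Q (P k l)` over the
left-shifted, respectively right-shifted, vectors of `α` and `β`. The two slots can therefore be
treated separately. -/
theorem isNcKernel_ofCoeff [AddCommGroup V] [Module ℂ V]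
    {T : NcPoint.IndexPair Ω → NcPoint.IndexPair Ω → E →ₗ[ℂ] (Y →L[ℂ] Y)}
    {Q : E →ₗ[ℂ] (NcPoint.IndexPair Ω →₀ Y) →ₗ⋆[ℂ] (NcPoint.IndexPair Ω →₀ Y) →ₗ[ℂ] ℂ}
    (hT : ∀ s t a u v, inner ℂ u (T s t a v) = Q a (Finsupp.single s u) (Finsupp.single t v))
    (hleft : ∀ (Z Z' : Ω) (α : Matrix (Fin Z'.1.size) (Fin Z.1.size) ℂ),
      scalarMulLeft α Z.1.mat = scalarMulRight Z'.1.mat α → ∀ i' k y a x,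
        Q a (shiftLeft α i' k y) x = Q a (shiftRight α i' k y) x)
    (hright : ∀ (Z Z' : Ω) (α : Matrix (Fin Z'.1.size) (Fin Z.1.size) ℂ),
      scalarMulLeft α Z.1.mat = scalarMulRight Z'.1.mat α → ∀ i' k y a x,
        Q a x (shiftLeft α i' k y) = Q a x (shiftRight α i' k y)) :
    IsNcKernel (ofCoeff T : GradedKernel Ω E Y) := by
  intro Z Z' W W' α β hα hβ P
  ext1 i' j'
  ext v
  refine ext_inner_left ℂ fun u => ?_
  have h1 : inner ℂ u ((scalarMulRight (scalarMulLeft α (ofCoeff T Z W P)) βᴴ) i' j' v)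
      = ∑ k, ∑ l, Q (P k l) (shiftLeft α i' k u) (shiftLeft β j' l v) := by
    simp only [scalarMulRight, scalarMulLeft, Matrix.of_apply, ofCoeff_apply, shiftLeft,
      map_sum, map_smulₛₗ, LinearMap.sum_apply, LinearMap.smul_apply, ← hT,
      sum_apply, smul_apply, inner_sum, inner_smul_right,
      Finset.mul_sum, Finset.smul_sum, Matrix.conjTranspose_apply, RingHom.id_apply, smul_eq_mul,
      Complex.star_def, Complex.conj_conj]
    exact Finset.sum_comm_pairs _ _ _ _ _
  have h2 : inner ℂ u ((ofCoeff T Z' W' (scalarMulRight (scalarMulLeft α P) βᴴ)) i' j' v)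
      = ∑ k, ∑ l, Q (P k l) (shiftRight α i' k u) (shiftRight β j' l v) := by
    simp only [scalarMulRight, scalarMulLeft, Matrix.of_apply, ofCoeff_apply, shiftRight,
      map_sum, map_smulₛₗ, LinearMap.sum_apply, LinearMap.smul_apply, ← hT,
      sum_apply, smul_apply, inner_sum, inner_smul_right,
      Finset.mul_sum, Finset.smul_sum, Matrix.conjTranspose_apply, RingHom.id_apply, smul_eq_mul,
      Complex.star_def, Complex.conj_conj]
    rw [Finset.sum_comm_pairs, Finset.sum_comm]
    exact Finset.sum_congr rfl fun k _ => Finset.sum_congr rfl fun l _ => Finset.sum_comm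
  rw [h1, h2]
  refine Finset.sum_congr rfl fun k _ => Finset.sum_congr rfl fun l _ => ?_
  rw [hleft Z Z' α hα, hright W W' β hβ]

/-- Against a vector supported at one index `(W, j, l)`, this is the nc identity for `α` on the
left, `β = 1` on the right, and the matrix with the single entry `e` at `(k, l)`. -/
theorem form_shiftLeft_eq [AddCommGroup V] [Module ℂ V] {K : GradedKernel Ω E Y}
    (hK : IsNcKernel K) {Z Z' : Ω} {α : Matrix (Fin Z'.1.size) (Fin Z.1.size) ℂ}
    (hα : scalarMulLeft α Z.1.mat = scalarMulRight Z'.1.mat α)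
    {κ : NcPoint.IndexPair Ω → NcPoint.IndexPair Ω → A →ₗ[ℂ] (Y →L[ℂ] Y)} {a : A} {e : E}
    (hκ : ∀ s t, κ s t a = K.coeff s t e) (i' : Fin Z'.1.size) (k : Fin Z.1.size) (y : Y) :
    formOfOperators κ a (shiftLeft α i' k y) = formOfOperators κ a (shiftRight α i' k y) := by
  refine Finsupp.lhom_ext fun t v => ?_
  obtain ⟨W, j, l⟩ := t
  have h := congrFun (congrFun (hK Z Z' W W α 1 hα (by
    ext i j; simp [scalarMulLeft, scalarMulRight, Matrix.one_apply]) (Matrix.single k l e)) i') j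
  have h' := congrArg (fun R : Y →L[ℂ] Y => inner ℂ y (R v)) h
  rw [apply_eq_sum_coeff K Z' W] at h'
  simp only [scalarMulRight, scalarMulLeft, Matrix.of_apply, Matrix.conjTranspose_one,
    Matrix.one_apply, ite_smul, one_smul, zero_smul, Finset.sum_ite_eq',
    Finset.mem_univ, if_true] at h'
  simp only [shiftLeft, shiftRight, map_sum, map_smulₛₗ, LinearMap.sum_apply,
    LinearMap.smul_apply, formOfOperators_single, hκ, coeff_apply, Complex.star_def,
    Complex.conj_conj]
  have hs : ∀ k' l', ∑ m, α k' m • (Matrix.single k l e : Matrix _ _ E) m l' =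
      if l = l' then α k' k • e else 0 := by
    intro k' l'
    rw [Finset.sum_eq_single k]
    · by_cases hl : l = l' <;> simp [hl]
    · intro m _ hm
      simp [Ne.symm hm]
    · simp
  simp only [hs, apply_ite (coeff K _ _), map_zero, Finset.sum_ite_eq, Finset.mem_univ, if_true,
    map_smul, sum_apply, smul_apply, inner_sum, inner_smul_right, coeff_apply] at h'
  exact h'

theorem isCPForm_formOfOperators {S : Submodule ℂ A} {K : GradedKernel Ω S Y}
    (hK : ∀ (k : ℕ) (Z : Fin k → Ω), IsCPMap S.subtype (K.blockMap Z))
    {κ : NcPoint.IndexPair Ω → NcPoint.IndexPair Ω → A →ₗ[ℂ] (Y →L[ℂ] Y)}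
    (hκ : ∀ s t (a : S), κ s t a = K.coeff s t a) : IsCPForm S (formOfOperators κ) := by
  classical
  intro n P x hPS hP
  let F : Finset Ω := Finset.univ.biUnion fun p => (x p).support.image Sigma.fst
  let Z : Fin F.card → Ω := fun i => F.equivFin.symm i
  -- The points must be listed without repetition, so that summing over `e` counts each support
  -- index once.
  have hZ : Function.Injective Z := Subtype.val_injective.comp F.equivFin.symm.injective
  let e : (Σ i, Fin (Z i).1.size × Fin (Z i).1.size) ↪ NcPoint.IndexPair Ω :=
    Function.Embedding.sigmaMap ⟨Z, hZ⟩ fun i => Function.Embedding.refl _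
  have he : ∀ p s, x p s ≠ 0 → s ∈ Set.range e := by
    rintro p ⟨W, i, j⟩ hs
    have hW : W ∈ F := by
      simp only [F, Finset.mem_biUnion, Finset.mem_image]
      exact ⟨p, Finset.mem_univ _, _, Finsupp.mem_support_iff.2 hs, rfl⟩
    obtain ⟨a, ha⟩ : ∃ a, Z a = W := ⟨F.equivFin ⟨W, hW⟩, by simp [Z]⟩
    subst ha
    exact ⟨⟨a, i, j⟩, rfl⟩
  let L := Σ i, Fin (Z i).1.size × Fin (Z i).1.size
  let I := Σ i, Fin (Z i).1.size
  let rowIdx : L → I := fun l => ⟨l.1, l.2.1⟩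
  let colIdx : L → I := fun l => ⟨l.1, l.2.2⟩
  let P' : Matrix (Fin n) (Fin n) S := Matrix.of fun p q => ⟨P p q, hPS p q⟩
  -- One block is taken for each pair `(p, s)`: the matrix unit picks out the column index of `s`,
  -- the test vector its row index, so that the pairing returns exactly the coefficient at `s, t`.
  -- The large matrix of matrix units is a 0/1 compression of `P`, hence positive.
  have h := (hK _ Z).sum_nonneg (R := Fin n × L)
    (fun a b => Matrix.single (colIdx a.2) (colIdx b.2) (P' a.1 b.1)) (by
      convert hP.congr (J := (Fin n × L) × I)
        (fun p a => if a.1.1 = p ∧ a.2 = colIdx a.1.2 then 1 else 0) using 1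
      ext a b
      simp only [Matrix.of_apply, Submodule.subtype_apply]
      by_cases ha : a.2 = colIdx a.1.2
      · by_cases hb : b.2 = colIdx b.1.2
        · simp [ha, hb, P']
        · simp [hb, Ne.symm hb]
      · simp [ha, Ne.symm ha])
    (fun a i => if i = rowIdx a.2 then x a.1 (e a.2) else 0)
  convert h using 1
  simp_rw [formOfOperators_eq_sum κ _ e (he _) (he _)]
  rw [Fintype.sum_prod_type]
  refine Finset.sum_congr rfl fun p _ => ?_
  rw [Finset.sum_comm]
  refine Finset.sum_congr rfl fun s _ => ?_
  rw [Finset.sum_eq_single (rowIdx s)]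
  · rw [Fintype.sum_prod_type]
    refine Finset.sum_congr rfl fun q _ => ?_
    refine Finset.sum_congr rfl fun t _ => ?_
    rw [Finset.sum_eq_single (rowIdx t)]
    · have hsingle : (Matrix.of fun i j => Matrix.single (colIdx s) (colIdx t) (P' p q)
          ⟨s.1, i⟩ ⟨t.1, j⟩) = Matrix.single s.2.2 t.2.2 (P' p q) := by
        ext i j
        have hI : ∀ a i j, (⟨a, i⟩ : I) = ⟨a, j⟩ ↔ i = j := fun _ _ _ => sigma_mk_injective.eq_iff
        simp only [Matrix.of_apply, Matrix.single_apply, colIdx, hI]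
      have hblock : κ (e s) (e t) (P p q) =
          K.blockMap Z (Matrix.single (colIdx s) (colIdx t) (P' p q)) (rowIdx s) (rowIdx t) := by
        refine (hκ (e s) (e t) (P' p q)).trans ?_
        change _ = K (Z s.1) (Z t.1) (Matrix.of fun i j => Matrix.single (colIdx s) (colIdx t)
          (P' p q) ⟨s.1, i⟩ ⟨t.1, j⟩) s.2.1 t.2.1
        rw [hsingle]
        rfl
      simp [hblock]
    · intro i _ hi; simp [hi]
    · simp
  · intro i _ hi; simp [hi]
  · simp

end GradedKernel

/-! ### The extension theorem -/

theorem theorem6p1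
    {V : Type*} [AddCommGroup V] [Module ℂ V] (Ω : Set (NcPoint V))
    {A : Type*} [CStarAlgebra A] (S : Submodule ℂ A) (hS : IsOperatorSystem S)
    {Y : Type*} [NormedAddCommGroup Y] [InnerProductSpace ℂ Y] [CompleteSpace Y]
    (K : GradedKernel Ω S Y) (hK : IsCPNcKernel S.subtype K) :
    ∃ K' : GradedKernel Ω A Y,
      IsCPNcKernel (LinearMap.id : A →ₗ[ℂ] A) K' ∧
      (∀ Z W : Ω, Continuous (K' Z W)) ∧
      ∀ (Z W : Ω) (P : Matrix (Fin Z.1.size) (Fin W.1.size) S),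
        K' Z W (P.map S.subtype) = K Z W P := by
  -- An arbitrary linear extension of each coefficient to `A`, taken only so that the forms are
  -- defined on all of `A`; its values off `S` play no role.
  choose κ hκ using fun s t : NcPoint.IndexPair Ω => (K.coeff s t).exists_extend
  replace hκ : ∀ s t (a : S), κ s t a = K.coeff s t a := fun s t a => LinearMap.congr_fun (hκ s t) a
  obtain ⟨Q, hQ, hQS⟩ :=
    (GradedKernel.isCPForm_formOfOperators hK.isCP hκ).exists_extension hS
  have hA : IsOperatorSystem (⊤ : Submodule ℂ A) := ⟨trivial, fun _ _ => trivial⟩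
  have hQ1 : Q 1 = formOfOperators κ 1 := hQS 1 hS.one_mem
  have hself : ∀ s (u : Y), (Q 1 (Finsupp.single s u) (Finsupp.single s u)).re
      ≤ ‖κ s s 1‖ * ‖u‖ ^ 2 := by
    intro s u
    rw [hQ1, formOfOperators_single]
    calc (inner ℂ u (κ s s 1 u)).re ≤ ‖inner ℂ u (κ s s 1 u)‖ := Complex.re_le_norm _
      _ ≤ ‖u‖ * ‖κ s s 1 u‖ := norm_inner_le_norm _ _
      _ ≤ ‖u‖ * (‖κ s s 1‖ * ‖u‖) := by gcongr; exact (κ s s 1).le_opNorm u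
      _ = ‖κ s s 1‖ * ‖u‖ ^ 2 := by ring
  have hnonneg : ∀ x, 0 ≤ (Q 1 x x).re := fun x =>
    (Complex.nonneg_iff.1 (hQ.apply_one_self_nonneg hA x)).1
  have hbound : ∀ s t a (u v : Y), ‖Q a (Finsupp.single s u) (Finsupp.single t v)‖
      ≤ Real.sqrt (‖κ s s 1‖ * ‖κ t t 1‖) * ‖a‖ * ‖u‖ * ‖v‖ := by
    intro s t a u v
    refine (pow_le_pow_iff_left₀ (norm_nonneg _) (by positivity) two_ne_zero).1 ?_
    refine (hQ.norm_sq_le hA (a := a) trivial _ _).trans ?_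
    calc _ ≤ (‖κ s s 1‖ * ‖u‖ ^ 2) * (‖a‖ ^ 2 * (‖κ t t 1‖ * ‖v‖ ^ 2)) := by
          gcongr
          · exact mul_nonneg (sq_nonneg _) (hnonneg _)
          · exact hself s u
          · exact hself t v
      _ = _ := by
          rw [mul_pow, mul_pow, mul_pow, Real.sq_sqrt (by positivity)]
          ring
  choose T hTcont hT using fun s t : NcPoint.IndexPair Ω =>
    exists_continuous_operator_of_form Q (Finsupp.lsingle s) (Finsupp.lsingle t)
      (Real.sqrt_nonneg _) (hbound s t)
  replace hT : ∀ s t a u v, inner ℂ u (T s t a v) =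
      Q a (Finsupp.single s u) (Finsupp.single t v) := hT
  have hTS : ∀ s t (a : S), T s t a = K.coeff s t a := by
    intro s t a
    ext v
    refine ext_inner_left ℂ fun u => ?_
    rw [hT, hQS a a.2, formOfOperators_single, hκ]
  -- The difference `x - y` is null for `Q 1`, so by Cauchy–Schwarz it is null for every `Q a`, in
  -- either slot.
  have hnull : ∀ x y, Q 1 x = Q 1 y → ∀ a z, Q a x z = Q a y z ∧ Q a z x = Q a z y := by
    intro x y hxy a z
    have h0 : Q 1 (x - y) (x - y) = 0 := by
      rw [show Q 1 (x - y) = 0 by rw [map_sub, hxy, sub_self], LinearMap.zero_apply]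
    have h1 := hQ.norm_sq_le hA (a := a) trivial (x - y) z
    have h2 := hQ.norm_sq_le hA (a := a) trivial z (x - y)
    rw [h0] at h1 h2
    simp only [Complex.zero_re, zero_mul, mul_zero] at h1 h2
    have h1' := norm_eq_zero.1 (pow_eq_zero_iff two_ne_zero |>.1 (le_antisymm h1 (sq_nonneg _)))
    have h2' := norm_eq_zero.1 (pow_eq_zero_iff two_ne_zero |>.1 (le_antisymm h2 (sq_nonneg _)))
    rw [map_sub, LinearMap.sub_apply] at h1'
    rw [map_sub] at h2'
    exact ⟨sub_eq_zero.1 h1', sub_eq_zero.1 h2'⟩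
  -- Only `Q 1` occurs here, and it is determined by `K` because `1 ∈ S`; this is where the nc
  -- property of `K` enters.
  have hshift : ∀ (Z Z' : Ω) (α : Matrix (Fin Z'.1.size) (Fin Z.1.size) ℂ),
      scalarMulLeft α Z.1.mat = scalarMulRight Z'.1.mat α → ∀ i' k (y : Y),
        Q 1 (GradedKernel.shiftLeft α i' k y) = Q 1 (GradedKernel.shiftRight α i' k y) := by
    intro Z Z' α hα i' k y
    rw [hQ1]
    exact GradedKernel.form_shiftLeft_eq hK.isNcKernel hα
      (fun s t => hκ s t ⟨1, hS.one_mem⟩) i' k y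
  refine ⟨GradedKernel.ofCoeff T, ⟨?_, ?_⟩, fun Z W => ?_, fun Z W P => ?_⟩
  · exact GradedKernel.isNcKernel_ofCoeff hT
      (fun Z Z' α hα i' k y a x => (hnull _ _ (hshift Z Z' α hα i' k y) a x).1)
      (fun Z Z' α hα i' k y a x => (hnull _ _ (hshift Z Z' α hα i' k y) a x).2)
  · exact GradedKernel.isCPMap_blockMap_ofCoeff hQ hT
  · refine continuous_matrix fun i j => ?_
    simp only [GradedKernel.ofCoeff_apply]
    exact continuous_finsetSum _ fun k _ => continuous_finsetSum _ fun l _ =>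
      (hTcont _ _).comp (continuous_id.matrix_elem k l)
  · ext1 i j
    rw [GradedKernel.ofCoeff_apply, K.apply_eq_sum_coeff]
    simp only [Matrix.map_apply, Submodule.subtype_apply, hTS]
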